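/- Let $\mathsf{Ab}_{t.f.}$ be the full subcategory of the category $\mathsf{Grp}$ of groups whose objects are the torsion-free abelian groups, with inclusion $H$, reflector $I\colon\mathsf{Grp}\to\mathsf{Ab}_{t.f.}$, $I(G)=G^{ab}/\mathrm{tors}(G^{ab})$, and unit $\eta_G\colon G\to HI(G)$. An \emph{extension} is a regular epimorphism (surjective homomorphism) of groups. An extension $f\colon E\to B$ is \emph{trivial} if the naturality square of $\eta$ at $f$ is a pullback; it is \emph{monadic} if the pullback functor $f^*$ from extensions of $B$ to extensions of $E$ is monadic; it is \emph{normal} if it is monadic and the projection $f^*(f)\colon E\times_BE\to E$ is trivial. A normal extension $p\colon E\to B$ is \emph{weakly universal} if for every normal extension $p'\colon E'\to B$ there is a homomorphism $u\colon E\to E'$ with $p'\circ u=p$. The \emph{Galois group} $\mathrm{Gal}(E,p,0)$ is the kernel of $\langle I(\pi_1),I(\pi_2)\rangle\colon I(E\times_BE)\to I(E)\times I(E)$ in $\mathsf{Ab}_{t.f.}$, and the \emph{fundamental group} $\pi_1(B)$ is $\mathrm{Gal}(E,p,0)$ for any weakly universal normal extension $p\colon E\to B$. Let $B$ be a group and $f\colon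 P\to B$ a surjective homomorphism with $P$ a free group and kernel $K$. Then $B$ has a weakly universal normal extension, and for every weakly universal normal extension $p\colon E\to B$ there is an isomorphism of groups $$\pi_1(B)=\mathrm{Gal}(E,p,0)\;\cong\;\frac{\{x\in K : \exists n\ge 1,\ x^n\in[P,P]\}}{\{x\in K : \exists n\ge 1,\ x^n\in[K,P]\}}.$$ (Both sets are subgroups of $P$, and the second is normal and contained in the first.) -/

import Mathlib

open CategoryTheory CategoryTheory.Limits

universe w v u

namespace GaloisPiOne

section Galois

/-- A Galois structure on a category with pullbacks: a full replete reflective subcategory `sub`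
with reflector `I` and adjunction `adj : I ⊣ H`, where `H = sub.ι` is the inclusion, together with
a class `ext` of morphisms (the extensions) which contains the isomorphisms, is closed under
composition, stable under pullback and preserved by `H ∘ I`. -/
structure GaloisStructure (A : Type u) [Category.{v} A] [HasPullbacks A] where
  sub : ObjectProperty A
  replete : sub.IsClosedUnderIsomorphisms
  I : A ⥤ sub.FullSubcategory
  adj : I ⊣ sub.ι
  ext : MorphismProperty A
  map_mem : ∀ {X Y : A} (f : X ⟶ Y), ext f → ext (sub.ι.map (I.map f))
  iso_mem : ∀ {X Y : A} (f : X ⟶ Y) [IsIso f], ext f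
  comp_mem : ∀ {X Y Z : A} (f : X ⟶ Y) (g : Y ⟶ Z), ext f → ext g → ext (f ≫ g)
  stable : ext.IsStableUnderBaseChange

variable {A : Type u} [Category.{v} A] [HasPullbacks A] (Γ : GaloisStructure A)

namespace GaloisStructure

/-- The full subcategory in which the reflector takes its values. -/
abbrev Sub : Type u := Γ.sub.FullSubcategory

/-- The unit of the reflection. -/
def η (X : A) : X ⟶ Γ.sub.ι.obj (Γ.I.obj X) := Γ.adj.unit.app X

/-- The pullback functor `p^*` from the extensions of `B` to the extensions of `E`, regarded as
full subcategories of the slice categories. -/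
noncomputable def pullbackFunctor {E B : A} (p : E ⟶ B) : Γ.ext.Over ⊤ B ⥤ Γ.ext.Over ⊤ E :=
  haveI := Γ.stable
  MorphismProperty.Over.pullback Γ.ext ⊤ p

/-- `p` is an extension and pulling back extensions along `p` is monadic. -/
def IsMonadicExtension {E B : A} (p : E ⟶ B) : Prop :=
  Γ.ext p ∧ Nonempty (MonadicRightAdjoint (Γ.pullbackFunctor p))

/-- `f` is an extension and its naturality square for the unit is a pullback. -/
def IsTrivialExtension {E B : A} (f : E ⟶ B) : Prop :=
  Γ.ext f ∧ IsPullback (Γ.η E) f (Γ.sub.ι.map (Γ.I.map f)) (Γ.η B)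

/-- `f` is a monadic extension and `f^*(f)`, a projection of its kernel pair, is trivial. -/
def IsNormalExtension {E B : A} (f : E ⟶ B) : Prop :=
  Γ.IsMonadicExtension f ∧ Γ.IsTrivialExtension (pullback.snd f f)

/-- A normal extension of `B` that factors through every normal extension of `B`. -/
def IsWeaklyUniversal {E B : A} (p : E ⟶ B) : Prop :=
  Γ.IsNormalExtension p ∧
    ∀ (E' : A) (p' : E' ⟶ B), Γ.IsNormalExtension p' → ∃ u : E ⟶ E', u ≫ p' = p

/-- The Galois group `Gal(E, p, 0)`: the pullback, in the subcategory, of `0 ⟶ I(E) × I(E)` along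
`⟨I(π₁), I(π₂)⟩ : I(E ×_B E) ⟶ I(E) × I(E)`. -/
noncomputable def galoisGroup [HasFiniteLimits Γ.Sub] [HasZeroObject Γ.Sub] {E B : A}
    (p : E ⟶ B) : Γ.Sub :=
  pullback (prod.lift (Γ.I.map (pullback.fst p p)) (Γ.I.map (pullback.snd p p)))
    ((isZero_zero Γ.Sub).to_ (Γ.I.obj E ⨯ Γ.I.obj E))

end GaloisStructure

end Galois

section TorsionFree

/-- The groups that are abelian and torsion-free. -/
def isAbTF : ObjectProperty GrpCat.{w} := fun G => IsMulCommutative G ∧ IsMulTorsionFree G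

/-- The category of torsion-free abelian groups, as a full subcategory of groups. -/
abbrev AbTF : Type (w + 1) := isAbTF.{w}.FullSubcategory

instance isAbTF_replete : isAbTF.{w}.IsClosedUnderIsomorphisms where
  of_iso {X Y} e h := by
    have hinj : Function.Injective e.inv.hom := e.symm.groupIsoToMulEquiv.injective
    obtain ⟨h1, h2⟩ := h
    refine ⟨⟨⟨fun a b => hinj ?_⟩⟩, ⟨fun n hn a b hab => hinj (h2.pow_left_injective hn ?_)⟩⟩
    · rw [map_mul, map_mul]
      exact h1.is_comm.comm _ _
    · have := congrArg e.inv.hom hab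
      simpa using this

/-- The composite of abelianisation with the quotient by the torsion subgroup. -/
abbrev ReflObj (G : Type w) [Group G] : Type w :=
  Abelianization G ⧸ CommGroup.torsion (Abelianization G)

/-- The canonical homomorphism from a group to its torsion-free abelian reflection. -/
def reflUnit (G : Type w) [Group G] : G →* ReflObj G :=
  (QuotientGroup.mk' (CommGroup.torsion (Abelianization G))).comp Abelianization.of

lemma reflUnit_surjective (G : Type w) [Group G] : Function.Surjective (reflUnit G) :=
  (QuotientGroup.mk'_surjective _).comp (QuotientGroup.mk'_surjective _)

lemma reflUnit_ker_le {G H : Type w} [Group G] [Group H] (h1 : IsMulCommutative H)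
    (h2 : IsMulTorsionFree H) (f : G →* H) : (reflUnit G).ker ≤ f.ker := by
  intro g hg
  let _ : CommGroup H := { (inferInstance : Group H) with mul_comm := h1.is_comm.comm }
  have hg' : Abelianization.of g ∈ CommGroup.torsion (Abelianization G) :=
    (QuotientGroup.eq_one_iff _).1 hg
  obtain ⟨n, hn, hgn⟩ := isOfFinOrder_iff_pow_eq_one.1 hg'
  have h3 : f g ^ n = 1 := by
    have := congrArg (Abelianization.lift f) hgn
    simpa using this
  exact h2.pow_left_injective hn.ne' (by simpa using h3)

/-- The torsion-free abelian reflection of a group, as an object of `AbTF`. -/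
def reflObj (G : GrpCat.{w}) : AbTF.{w} :=
  ⟨GrpCat.of (ReflObj G), ⟨⟨mul_comm⟩⟩, inferInstance⟩

/-- The factorisation through the reflection of a homomorphism to a torsion-free abelian group. -/
noncomputable def reflLift {G H : Type w} [Group G] [Group H] (h1 : IsMulCommutative H)
    (h2 : IsMulTorsionFree H) (f : G →* H) : ReflObj G →* H :=
  (reflUnit G).liftOfSurjective (reflUnit_surjective G) ⟨f, reflUnit_ker_le h1 h2 f⟩

lemma reflLift_reflUnit {G H : Type w} [Group G] [Group H] (h1 : IsMulCommutative H)
    (h2 : IsMulTorsionFree H) (f : G →* H) (g : G) :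
    reflLift h1 h2 f (reflUnit G g) = f g :=
  (reflUnit G).liftOfRightInverse_comp_apply _ _ ⟨f, reflUnit_ker_le h1 h2 f⟩ g

/-- The universal property of the reflection. -/
noncomputable def reflHomEquiv (G : GrpCat.{w}) (X : AbTF.{w}) :
    (reflObj G ⟶ X) ≃ (G ⟶ isAbTF.ι.obj X) where
  toFun φ := GrpCat.ofHom (φ.hom.hom.comp (reflUnit G))
  invFun f := ObjectProperty.homMk
    (GrpCat.ofHom (reflLift X.property.1 X.property.2 f.hom))
  left_inv φ := by
    ext x
    obtain ⟨g, rfl⟩ := reflUnit_surjective G x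
    exact reflLift_reflUnit X.property.1 X.property.2 _ g
  right_inv f := by
    ext g
    exact reflLift_reflUnit X.property.1 X.property.2 f.hom g

/-- The reflector from groups to torsion-free abelian groups. -/
noncomputable def reflector : GrpCat.{w} ⥤ AbTF.{w} :=
  Adjunction.leftAdjointOfEquiv (G := isAbTF.ι) reflHomEquiv (fun _ _ _ _ _ => rfl)

/-- The reflector is left adjoint to the inclusion. -/
noncomputable def reflAdj : reflector.{w} ⊣ isAbTF.ι :=
  Adjunction.adjunctionOfEquivLeft (G := isAbTF.ι) reflHomEquiv (fun _ _ _ _ _ => rfl)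

lemma isRegularEpi_iff_surjective {X Y : GrpCat.{w}} (f : X ⟶ Y) :
    IsRegularEpi f ↔ Function.Surjective f.hom := by
  constructor
  · intro h
    exact (GrpCat.epi_iff_surjective f).1 inferInstance
  · intro hf
    have key (s : Cofork (GrpCat.ofHom f.hom.ker.subtype) (GrpCat.ofHom 1)) :
        f.hom.ker ≤ s.π.hom.ker := fun x hx => by
      simpa using congrArg (fun g => g.hom (⟨x, hx⟩ : f.hom.ker)) s.condition
    have fac (s : Cofork (GrpCat.ofHom f.hom.ker.subtype) (GrpCat.ofHom 1)) (x : X) :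
        f.hom.liftOfSurjective hf ⟨s.π.hom, key s⟩ (f.hom x) = s.π.hom x :=
      f.hom.liftOfRightInverse_comp_apply _ (Function.rightInverse_surjInv hf)
        ⟨s.π.hom, key s⟩ x
    refine ⟨⟨{ W := GrpCat.of f.hom.ker
               left := GrpCat.ofHom f.hom.ker.subtype
               right := GrpCat.ofHom 1
               w := ?_
               isColimit := Cofork.IsColimit.mk _
                (fun s => GrpCat.ofHom (f.hom.liftOfSurjective hf ⟨s.π.hom, key s⟩))
                (fun s => ?_) (fun s m hm => ?_) }⟩⟩
    · ext x
      exact (MonoidHom.mem_ker.1 x.2).trans (map_one f.hom).symm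
    · ext x
      exact fac s x
    · ext y
      obtain ⟨x, rfl⟩ := hf y
      exact (congrArg (fun g => g.hom x) hm).trans (fac s x).symm

lemma reflAdj_unit_app (G : GrpCat.{w}) : reflAdj.unit.app G = GrpCat.ofHom (reflUnit G) := by
  rfl

/-- The Galois structure given by the reflection of groups to torsion-free abelian groups, the
extensions being the regular epimorphisms. -/
noncomputable def ΓTF : GaloisStructure GrpCat.{w} where
  sub := isAbTF
  replete := inferInstance
  I := reflector
  adj := reflAdj
  ext := MorphismProperty.regularEpi GrpCat
  map_mem {X Y} f hf := by
    rw [MorphismProperty.regularEpi_iff, isRegularEpi_iff_surjective] at hf ⊢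
    intro y
    obtain ⟨z, rfl⟩ := reflUnit_surjective Y y
    obtain ⟨x, rfl⟩ := hf z
    exact ⟨reflUnit X x, (congrArg (fun g => g.hom x) (reflAdj.unit.naturality f)).symm⟩
  iso_mem f _ := by
    rw [MorphismProperty.regularEpi_iff]
    infer_instance
  comp_mem f g hf hg := by
    rw [MorphismProperty.regularEpi_iff, isRegularEpi_iff_surjective] at hf hg ⊢
    exact hg.comp hf
  stable := MorphismProperty.IsStableUnderBaseChange.mk fun {X Y Y' S} f g f' g' sq hg => by
    rw [MorphismProperty.regularEpi_iff, isRegularEpi_iff_surjective] at hg ⊢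
    intro x
    obtain ⟨y, hy⟩ := hg (f x)
    obtain ⟨z, _, hz⟩ := Types.exists_of_isPullback (sq.map (forget GrpCat)) y x hy
    exact ⟨z, hz⟩

noncomputable instance : Reflective isAbTF.{w}.ι where
  L := reflector
  adj := reflAdj

instance : HasFiniteLimits ΓTF.{w}.Sub :=
  haveI : HasLimits isAbTF.{w}.FullSubcategory := hasLimits_of_reflective isAbTF.ι
  inferInstanceAs (HasFiniteLimits isAbTF.{w}.FullSubcategory)

instance : HasZeroObject ΓTF.{w}.Sub :=
  ⟨⟨GrpCat.of PUnit, ⟨⟨mul_comm⟩⟩, ⟨fun _ _ _ _ _ => Subsingleton.elim _ _⟩⟩,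
    IsZero.of_full_of_faithful_of_isZero isAbTF.ι _
      (GrpCat.isZero_of_subsingleton (GrpCat.of PUnit))⟩

end TorsionFree

section Isolator

variable {P : Type w} [Group P]

/-- For normal subgroups `K` and `N` of `P` with `[K, K] ≤ N`, the normal subgroup
`{p ∈ K | ∃ n ≥ 1, pⁿ ∈ N}` of `P`. -/
def rootsIn (K N : Subgroup P) [N.Normal] (h : ⁅K, K⁆ ≤ N) : Subgroup P where
  carrier := {p | p ∈ K ∧ ∃ n : ℕ, 0 < n ∧ p ^ n ∈ N}
  one_mem' := ⟨K.one_mem, 1, one_pos, by simp⟩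
  mul_mem' := by
    rintro a b ⟨ha, n, hn, han⟩ ⟨hb, m, hm, hbm⟩
    refine ⟨K.mul_mem ha hb, n * m, Nat.mul_pos hn hm, ?_⟩
    have hc : Commute (a : P ⧸ N) (b : P ⧸ N) := by
      rw [← commutatorElement_eq_one_iff_commute]
      exact (QuotientGroup.eq_one_iff _).2 (h (Subgroup.commutator_mem_commutator ha hb))
    rw [← QuotientGroup.eq_one_iff] at han hbm ⊢
    rw [QuotientGroup.mk_pow] at han hbm ⊢
    rw [QuotientGroup.mk_mul]
    rw [hc.mul_pow, pow_mul, han, mul_comm n m, pow_mul, hbm, one_pow, one_pow, one_mul]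
  inv_mem' := by
    rintro a ⟨ha, n, hn, han⟩
    exact ⟨K.inv_mem ha, n, hn, by rw [inv_pow]; exact N.inv_mem han⟩

instance rootsIn_normal (K N : Subgroup P) [hK : K.Normal] [hN : N.Normal] (h : ⁅K, K⁆ ≤ N) :
    (rootsIn K N h).Normal where
  conj_mem := by
    rintro a ⟨ha, n, hn, han⟩ g
    exact ⟨hK.conj_mem a ha g, n, hn, by rw [conj_pow]; exact hN.conj_mem _ han g⟩

/-- The numerator `{p ∈ K | ∃ n ≥ 1, pⁿ ∈ [P, P]}`. -/
def hopfNum (K : Subgroup P) [K.Normal] : Subgroup P :=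
  rootsIn K ⁅(⊤ : Subgroup P), ⊤⁆ (Subgroup.commutator_mono le_top le_top)

/-- The denominator `{p ∈ K | ∃ n ≥ 1, pⁿ ∈ [K, P]}`. -/
def hopfDen (K : Subgroup P) [K.Normal] : Subgroup P :=
  rootsIn K ⁅K, (⊤ : Subgroup P)⁆ (Subgroup.commutator_mono le_rfl le_top)

instance hopfDen_normal (K : Subgroup P) [K.Normal] : (hopfDen K).Normal :=
  rootsIn_normal _ _ _

/-- The denominator is contained in the numerator, so that the intersection with the numerator
taken in `HopfQuotient` changes nothing. -/
lemma hopfDen_le_hopfNum (K : Subgroup P) [K.Normal] : hopfDen K ≤ hopfNum K := by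
  rintro a ⟨ha, n, hn, han⟩
  exact ⟨ha, n, hn, Subgroup.commutator_mono le_top le_rfl han⟩

/-- The quotient group `{p ∈ K | ∃ n ≥ 1, pⁿ ∈ [P, P]} / {p ∈ K | ∃ n ≥ 1, pⁿ ∈ [K, P]}`. -/
abbrev HopfQuotient (K : Subgroup P) [K.Normal] : Type w :=
  hopfNum K ⧸ (hopfDen K).subgroupOf (hopfNum K)

end Isolator

end GaloisPiOne

/-!
Let `(π₁, π₂)` be the kernel pair of a homomorphism `p : E ⟶ B`. An element `(k, 1)` of it is
killed by the torsion-free abelian reflection if and only if `k ∈ hopfDen (ker p)`. Indeed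
`⁅(k, 1), (e, e)⁆ = (⁅k, e⁆, 1)`; conversely, two homomorphisms with the same composite with `p`
differ, on an element killed by the reflection, by an element of `hopfDen (ker p)`, and `π₁`, `π₂`
are two such homomorphisms. Two consequences:

* a surjective `p` is monadic by Beck's theorem, hence normal if and only if `hopfDen (ker p) = ⊥`,
  that is, `p` is a central extension with torsion-free kernel;
* the Galois group of every `p` is the Hopf quotient of `ker p`.

The Hopf quotient of `ker p` is functorial in `p`, and the map induced by a homomorphism over `B`
does not depend on that homomorphism. So any two weakly universal normal extensions have the same
Hopf quotient. One of them is `P ⧸ hopfDen (ker f) ⟶ B`, because `P` is free, and it has the same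
Hopf quotient as `f`.
-/

namespace GaloisPiOne

open scoped commutatorElement

section Roots

variable {G H : Type*} [Group G] [Group H] {K N : Subgroup G} [N.Normal] {h : ⁅K, K⁆ ≤ N}
  {K' N' : Subgroup H} [N'.Normal] {h' : ⁅K', K'⁆ ≤ N'}

lemma rootsIn_le_comap {φ : G →* H} (hK : K ≤ K'.comap φ) (hN : N ≤ N'.comap φ) :
    rootsIn K N h ≤ (rootsIn K' N' h').comap φ := by
  rintro x ⟨hx, n, hn, hxn⟩
  refine ⟨hK hx, n, hn, ?_⟩
  rw [← map_pow]
  exact hN hxn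

lemma comap_rootsIn_le {φ : G →* H} (hK : K'.comap φ ≤ K) (hN : N' ≤ N.map φ)
    (hφ : φ.ker ≤ rootsIn K N h) : (rootsIn K' N' h').comap φ ≤ rootsIn K N h := by
  rintro x ⟨hx, n, hn, hxn⟩
  obtain ⟨c, hc, hcx⟩ := hN hxn
  obtain ⟨-, m, hm, hcm⟩ : c⁻¹ * x ^ n ∈ rootsIn K N h :=
    hφ (by rw [MonoidHom.mem_ker, map_mul, map_inv, hcx, map_pow, inv_mul_cancel])
  refine ⟨hK hx, n * m, Nat.mul_pos hn hm, ?_⟩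
  replace hc : c ∈ N := hc
  rw [← QuotientGroup.eq_one_iff] at hc hcm ⊢
  simpa [hc, pow_mul] using hcm

end Roots

section Hopf

variable {G E P : Type w} {B : Type*} [Group G] [Group E] [Group P] [Group B]

lemma reflUnit_eq_one_iff {g : G} :
    reflUnit G g = 1 ↔ ∃ n : ℕ, 0 < n ∧ g ^ n ∈ ⁅(⊤ : Subgroup G), (⊤ : Subgroup G)⁆ := by
  refine (QuotientGroup.eq_one_iff _).trans (isOfFinOrder_iff_pow_eq_one.trans ?_)
  refine exists_congr fun n => and_congr_right fun _ => ?_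
  rw [← map_pow]
  exact QuotientGroup.eq_one_iff _

lemma mem_hopfNum_iff {K : Subgroup G} [K.Normal] {g : G} :
    g ∈ hopfNum K ↔ g ∈ K ∧ reflUnit G g = 1 :=
  and_congr_right' reflUnit_eq_one_iff.symm

lemma commutator_le_comap_commutator {φ : G →* E} {K₁ K₂ : Subgroup G} {L₁ L₂ : Subgroup E}
    (h₁ : K₁ ≤ L₁.comap φ) (h₂ : K₂ ≤ L₂.comap φ) : ⁅K₁, K₂⁆ ≤ ⁅L₁, L₂⁆.comap φ := by
  rw [← Subgroup.map_le_iff_le_comap] at h₁ h₂ ⊢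
  rw [Subgroup.map_commutator]
  exact Subgroup.commutator_mono h₁ h₂

section Functoriality

variable {f : P →* B} {q : E →* B} {φ : P →* E}

lemma ker_eq_comap_ker (hφ : q.comp φ = f) : f.ker = q.ker.comap φ := by
  rw [MonoidHom.comap_ker, hφ]

lemma hopfNum_le_comap (hφ : q.comp φ = f) : hopfNum f.ker ≤ (hopfNum q.ker).comap φ :=
  rootsIn_le_comap (ker_eq_comap_ker hφ).le (commutator_le_comap_commutator le_top le_top)

lemma hopfDen_le_comap (hφ : q.comp φ = f) : hopfDen f.ker ≤ (hopfDen q.ker).comap φ :=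
  rootsIn_le_comap (ker_eq_comap_ker hφ).le
    (commutator_le_comap_commutator (ker_eq_comap_ker hφ).le le_top)

lemma comap_hopfNum (hφ : q.comp φ = f) (hs : Function.Surjective φ)
    (hker : φ.ker ≤ hopfNum f.ker) : (hopfNum q.ker).comap φ = hopfNum f.ker := by
  refine (comap_rootsIn_le (ker_eq_comap_ker hφ).ge ?_ hker).antisymm (hopfNum_le_comap hφ)
  rw [Subgroup.map_commutator, Subgroup.map_top_of_surjective φ hs]

lemma comap_hopfDen (hφ : q.comp φ = f) (hs : Function.Surjective φ)
    (hker : φ.ker ≤ hopfDen f.ker) : (hopfDen q.ker).comap φ = hopfDen f.ker := by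
  refine (comap_rootsIn_le (ker_eq_comap_ker hφ).ge ?_ hker).antisymm (hopfDen_le_comap hφ)
  rw [Subgroup.map_commutator, Subgroup.map_top_of_surjective φ hs, ker_eq_comap_ker hφ,
    Subgroup.map_comap_eq_self_of_surjective hs]

end Functoriality

section Difference

lemma commute_mk_of_mem {K : Subgroup E} [K.Normal] {k : E} (hk : k ∈ K) (e : E) :
    Commute (k : E ⧸ ⁅K, (⊤ : Subgroup E)⁆) e :=
  commutatorElement_eq_one_iff_commute.1 <| (QuotientGroup.eq_one_iff _).2 <|
    Subgroup.commutator_mem_commutator hk (Subgroup.mem_top e)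

lemma commutatorElement_mul_mul_of_mem_center {z₁ z₂ : G} (hz₁ : z₁ ∈ Subgroup.center G)
    (hz₂ : z₂ ∈ Subgroup.center G) (a b : G) : ⁅z₁ * a, z₂ * b⁆ = ⁅a, b⁆ := by
  have comm₁ (x : G) : Commute z₁ x := (Subgroup.mem_center_iff.1 hz₁ x).symm
  have comm₂ (x : G) : Commute x z₂ := Subgroup.mem_center_iff.1 hz₂ x
  rw [commutatorElement_mul_left_eq_conj_mul, (comm₁ _).commutator_eq, (comm₁ _).mul_inv_cancel,
    mul_one, commutatorElement_mul_right_eq_mul_conj, (comm₂ _).commutator_eq, one_mul,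
    (comm₂ _).symm.mul_inv_cancel]

variable {q : E →* B} {φ ψ : G →* E}

lemma div_mem_ker (h : q.comp φ = q.comp ψ) (g : G) : φ g / ψ g ∈ q.ker := by
  rw [MonoidHom.mem_ker, map_div, div_eq_one]
  exact DFunLike.congr_fun h g

lemma div_mem_commutator_of_mem_commutator (h : q.comp φ = q.comp ψ) {g : G}
    (hg : g ∈ ⁅(⊤ : Subgroup G), (⊤ : Subgroup G)⁆) : φ g / ψ g ∈ ⁅q.ker, (⊤ : Subgroup E)⁆ := by
  let π : E →* E ⧸ ⁅q.ker, (⊤ : Subgroup E)⁆ := QuotientGroup.mk' _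
  have hcentral (a : G) : π (φ a / ψ a) ∈ Subgroup.center _ := by
    refine Subgroup.mem_center_iff.2 fun e => ?_
    obtain ⟨e, rfl⟩ := QuotientGroup.mk_surjective e
    exact (commute_mk_of_mem (div_mem_ker h a) e).eq.symm
  have hφ (a : G) : π (φ a) = π (φ a / ψ a) * π (ψ a) := by rw [← map_mul, div_mul_cancel]
  have hle : ⁅(⊤ : Subgroup G), (⊤ : Subgroup G)⁆ ≤ (π.comp φ).eqLocus (π.comp ψ) := by
    refine Subgroup.commutator_le.2 fun a _ b _ => ?_
    change π (φ ⁅a, b⁆) = π (ψ ⁅a, b⁆)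
    simp only [map_commutatorElement]
    rw [hφ a, hφ b, commutatorElement_mul_mul_of_mem_center (hcentral a) (hcentral b)]
  exact QuotientGroup.eq_iff_div_mem.1 (hle hg)

lemma div_mem_hopfDen (h : q.comp φ = q.comp ψ) {g : G} (hg : reflUnit G g = 1) :
    φ g / ψ g ∈ hopfDen q.ker := by
  obtain ⟨n, hn, hgn⟩ := reflUnit_eq_one_iff.1 hg
  refine ⟨div_mem_ker h g, n, hn, ?_⟩
  have hpow : ((φ (g ^ n) : E) : E ⧸ ⁅q.ker, (⊤ : Subgroup E)⁆) = ψ (g ^ n) :=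
    QuotientGroup.eq_iff_div_mem.2 (div_mem_commutator_of_mem_commutator h hgn)
  rw [map_pow, map_pow, ← div_mul_cancel (φ g) (ψ g), QuotientGroup.mk_pow, QuotientGroup.mk_mul,
    (commute_mk_of_mem (div_mem_ker h g) _).mul_pow, QuotientGroup.mk_pow, mul_eq_right] at hpow
  exact (QuotientGroup.eq_one_iff _).1 hpow

end Difference

section HopfMap

variable {f : P →* B} {q : E →* B}

/-- The map of Hopf quotients of kernels induced by a homomorphism over `B`. -/
def hopfMap (φ : P →* E) (hφ : q.comp φ = f) : HopfQuotient f.ker →* HopfQuotient q.ker :=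
  QuotientGroup.map _ _
    ((φ.subgroupComap (hopfNum q.ker)).comp (Subgroup.inclusion (hopfNum_le_comap hφ)))
    fun _ hx => hopfDen_le_comap hφ hx

lemma hopfMap_comp_hopfMap {φ : P →* E} (hφ : q.comp φ = f) {ψ : E →* P} (hψ : f.comp ψ = q) :
    (hopfMap ψ hψ).comp (hopfMap φ hφ) = MonoidHom.id _ := by
  refine QuotientGroup.monoidHom_ext _ (MonoidHom.ext fun x => ?_)
  have hover : f.comp (ψ.comp φ) = f.comp (MonoidHom.id P) := by
    rw [← MonoidHom.comp_assoc, hψ, hφ, MonoidHom.comp_id]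
  exact QuotientGroup.eq_iff_div_mem.2 (div_mem_hopfDen hover (mem_hopfNum_iff.1 x.2).2)

/-- The isomorphism of Hopf quotients given by homomorphisms over `B` in both directions, which
need not be mutually inverse. -/
def hopfEquiv (φ : P →* E) (hφ : q.comp φ = f) (ψ : E →* P) (hψ : f.comp ψ = q) :
    HopfQuotient f.ker ≃* HopfQuotient q.ker :=
  (hopfMap φ hφ).toMulEquiv (hopfMap ψ hψ) (hopfMap_comp_hopfMap hφ hψ)
    (hopfMap_comp_hopfMap hψ hφ)

lemma hopfMap_bijective {φ : P →* E} (hφ : q.comp φ = f) (hs : Function.Surjective φ)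
    (hker : φ.ker ≤ hopfDen f.ker) : Function.Bijective (hopfMap φ hφ) := by
  constructor
  · refine (injective_iff_map_eq_one _).2 fun x hx => ?_
    obtain ⟨x, rfl⟩ := QuotientGroup.mk_surjective x
    have hx' : x.1 ∈ (hopfDen q.ker).comap φ :=
      (QuotientGroup.eq_one_iff (N := (hopfDen q.ker).subgroupOf (hopfNum q.ker)) _).1 hx
    exact (QuotientGroup.eq_one_iff x).2 (comap_hopfDen hφ hs hker ▸ hx')
  · intro y
    obtain ⟨⟨y, hy⟩, rfl⟩ := QuotientGroup.mk_surjective y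
    obtain ⟨x, rfl⟩ := hs y
    have hx : x ∈ hopfNum f.ker :=
      comap_hopfNum hφ hs (hker.trans (hopfDen_le_hopfNum _)) ▸ hy
    exact ⟨QuotientGroup.mk ⟨x, hx⟩, rfl⟩

end HopfMap

section CentralReflection

/-- The homomorphism to `B` induced by `f` on `P ⧸ hopfDen f.ker`: for surjective `f`, the universal
way to make `f` a central extension with torsion-free kernel. -/
def centralReflection (f : P →* B) : P ⧸ hopfDen f.ker →* B :=
  QuotientGroup.lift (hopfDen f.ker) f fun _ hx => hx.1

variable {f : P →* B}

lemma centralReflection_comp_mk' :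
    (centralReflection f).comp (QuotientGroup.mk' (hopfDen f.ker)) = f := rfl

lemma centralReflection_surjective (hf : Function.Surjective f) :
    Function.Surjective (centralReflection f) :=
  Function.Surjective.of_comp (g := QuotientGroup.mk' (hopfDen f.ker)) hf

lemma hopfDen_ker_centralReflection : hopfDen (centralReflection f).ker = ⊥ := by
  have hs := QuotientGroup.mk'_surjective (hopfDen f.ker)
  rw [← Subgroup.map_comap_eq_self_of_surjective hs (hopfDen _),
    comap_hopfDen centralReflection_comp_mk' hs (QuotientGroup.ker_mk' _).le,
    QuotientGroup.map_mk'_self]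

lemma exists_comp_eq_centralReflection {q : E →* B} (hq : hopfDen q.ker = ⊥) {φ : P →* E}
    (hφ : q.comp φ = f) : ∃ u : P ⧸ hopfDen f.ker →* E, q.comp u = centralReflection f := by
  have hker : hopfDen f.ker ≤ φ.ker := by
    simpa only [hq, MonoidHom.comap_bot] using hopfDen_le_comap hφ
  refine ⟨QuotientGroup.lift _ φ hker, QuotientGroup.monoidHom_ext _ ?_⟩
  exact hφ

/-- Passing from `f` to its central reflection does not change the Hopf quotient. -/
noncomputable def centralReflectionEquiv (f : P →* B) :
    HopfQuotient f.ker ≃* HopfQuotient (centralReflection f).ker :=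
  MulEquiv.ofBijective (hopfMap _ centralReflection_comp_mk') <|
    hopfMap_bijective _ (QuotientGroup.mk'_surjective _) (QuotientGroup.ker_mk' _).le

end CentralReflection

lemma exists_comp_eq_of_isFreeGroup [IsFreeGroup P] {q : E →* B} (hq : Function.Surjective q)
    (f : P →* B) : ∃ φ : P →* E, q.comp φ = f := by
  refine ⟨IsFreeGroup.lift fun a => Function.surjInv hq (f (IsFreeGroup.of a)),
    IsFreeGroup.ext_hom fun a => ?_⟩
  rw [MonoidHom.comp_apply, IsFreeGroup.lift_of]
  exact Function.surjInv_eq hq _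

end Hopf

section Pullback

variable {W X Y S : GrpCat.{w}} {fst : W ⟶ X} {snd : W ⟶ Y} {f : X ⟶ S} {g : Y ⟶ S}

lemma exists_of_isPullback (h : IsPullback fst snd f g) {x : X} {y : Y}
    (hxy : f.hom x = g.hom y) : ∃ z : W, fst.hom z = x ∧ snd.hom z = y :=
  Types.exists_of_isPullback (h.map (forget GrpCat)) x y hxy

lemma ext_of_isPullback (h : IsPullback fst snd f g) {z z' : W}
    (h₁ : fst.hom z = fst.hom z') (h₂ : snd.hom z = snd.hom z') : z = z' :=
  Types.ext_of_isPullback (h.map (forget GrpCat)) h₁ h₂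

lemma eq_one_of_isPullback (h : IsPullback fst snd f g) {z : W}
    (h₁ : fst.hom z = 1) (h₂ : snd.hom z = 1) : z = 1 :=
  ext_of_isPullback h (h₁.trans (map_one _).symm) (h₂.trans (map_one _).symm)

lemma isPullback_of_exists_of_eq_one (w : fst ≫ f = snd ≫ g)
    (hexists : ∀ (x : X) (y : Y), f.hom x = g.hom y → ∃ z : W, fst.hom z = x ∧ snd.hom z = y)
    (heq_one : ∀ z : W, fst.hom z = 1 → snd.hom z = 1 → z = 1) : IsPullback fst snd f g := by
  refine IsPullback.of_map (forget GrpCat) w ((Types.isPullback_iff _ _ _ _).2 ⟨?_, ?_, hexists⟩)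
  · rw [← Functor.map_comp, w, Functor.map_comp]
  · rintro x y ⟨hx, hy⟩
    replace hx : fst.hom x = fst.hom y := hx
    replace hy : snd.hom x = snd.hom y := hy
    refine div_eq_one.1 (heq_one _ ?_ ?_)
    · rw [map_div, hx, div_self']
    · rw [map_div, hy, div_self']

lemma surjective_fst_of_isPullback (h : IsPullback fst snd f g)
    (hg : Function.Surjective g.hom) : Function.Surjective fst.hom := fun x => by
  obtain ⟨y, hy⟩ := hg (f.hom x)
  obtain ⟨z, hz, -⟩ := exists_of_isPullback h hy.symm
  exact ⟨z, hz⟩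

end Pullback

section Coequalizer

variable {X Y Z T : Type*} [Group X] [Group Y] [Group Z] [Group T]

/-- The normal subgroup by which to divide `Y` in order to coequalize `r` and `s`. -/
def coequalizerKer (r s : X →* Y) : Subgroup Y :=
  Subgroup.normalClosure (Set.range fun x => r x / s x)

instance coequalizerKer_normal (r s : X →* Y) : (coequalizerKer r s).Normal :=
  Subgroup.normalClosure_normal

variable {r s : X →* Y}

lemma coequalizerKer_le_iff {N : Subgroup Y} [N.Normal] :
    coequalizerKer r s ≤ N ↔ ∀ x, r x / s x ∈ N :=
  Subgroup.normalClosure_subset_iff.symm.trans Set.range_subset_iff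

lemma coequalizerKer_le_ker_iff {t : Y →* T} :
    coequalizerKer r s ≤ t.ker ↔ t.comp r = t.comp s := by
  simp only [coequalizerKer_le_iff, MonoidHom.mem_ker, map_div, div_eq_one, MonoidHom.ext_iff,
    MonoidHom.comp_apply]

/-- `π` is a coequalizer of `r` and `s`, described by its kernel so as to be checked on elements. -/
structure IsGroupCoequalizer (r s : X →* Y) (π : Y →* Z) : Prop where
  surjective : Function.Surjective π
  ker_eq : π.ker = coequalizerKer r s

variable {π : Y →* Z}

lemma IsGroupCoequalizer.comp_eq (h : IsGroupCoequalizer r s π) : π.comp r = π.comp s :=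
  coequalizerKer_le_ker_iff.1 h.ker_eq.ge

lemma IsGroupCoequalizer.existsUnique_comp_eq (h : IsGroupCoequalizer r s π) {t : Y →* T}
    (ht : t.comp r = t.comp s) : ∃! d : Z →* T, d.comp π = t := by
  have hker : π.ker ≤ t.ker := h.ker_eq.trans_le (coequalizerKer_le_ker_iff.2 ht)
  have hlift := π.liftOfRightInverse_comp _ (Function.rightInverse_surjInv h.surjective) ⟨t, hker⟩
  exact ⟨_, hlift, fun d hd => (MonoidHom.cancel_right h.surjective).1 (hd.trans hlift.symm)⟩

end Coequalizer

section Over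

variable {S : GrpCat.{w}} {X Y Z : ΓTF.{w}.ext.Over ⊤ S} {r s : X ⟶ Y} {π : Y ⟶ Z}

lemma over_w_apply (g : X ⟶ Y) (x : X.left) : Y.hom.hom (g.left.hom x) = X.hom.hom x :=
  ConcreteCategory.congr_hom (MorphismProperty.Over.w g) x

lemma IsGroupCoequalizer.w (h : IsGroupCoequalizer r.left.hom s.left.hom π.left.hom) :
    r ≫ π = s ≫ π := by
  ext x
  exact DFunLike.congr_fun h.comp_eq x

lemma IsGroupCoequalizer.nonempty_isColimit
    (h : IsGroupCoequalizer r.left.hom s.left.hom π.left.hom) :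
    Nonempty (IsColimit (Cofork.ofπ π h.w)) := by
  refine ⟨Cofork.IsColimit.ofExistsUnique fun t => ?_⟩
  have ht : t.π.left.hom.comp r.left.hom = t.π.left.hom.comp s.left.hom :=
    congrArg (fun k => k.left.hom) t.condition
  obtain ⟨d, hd, hunique⟩ := h.existsUnique_comp_eq ht
  have hover : GrpCat.ofHom d ≫ t.pt.hom = Z.hom := by
    ext z
    obtain ⟨y, rfl⟩ := h.surjective z
    change t.pt.hom.hom (d.comp π.left.hom y) = _
    rw [hd, over_w_apply, over_w_apply]
  refine ⟨MorphismProperty.Over.homMk (GrpCat.ofHom d) hover, ?_, fun d' hd' => ?_⟩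
  · ext y
    exact DFunLike.congr_fun hd y
  · ext z
    exact DFunLike.congr_fun (hunique d'.left.hom (congrArg (fun k => k.left.hom) hd')) z

lemma exists_isGroupCoequalizer (r s : X ⟶ Y) :
    ∃ (Z : ΓTF.{w}.ext.Over ⊤ S) (π : Y ⟶ Z),
      IsGroupCoequalizer r.left.hom s.left.hom π.left.hom := by
  let N := coequalizerKer r.left.hom s.left.hom
  have hN : N ≤ Y.hom.hom.ker := coequalizerKer_le_ker_iff.2 <| MonoidHom.ext fun x =>
    (over_w_apply r x).trans (over_w_apply s x).symm
  let q : GrpCat.of (Y.left ⧸ N) ⟶ S := GrpCat.ofHom (QuotientGroup.lift N Y.hom.hom hN)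
  have hq : Function.Surjective q.hom :=
    QuotientGroup.lift_surjective_of_surjective _ _ ((isRegularEpi_iff_surjective _).1 Y.prop) hN
  exact ⟨MorphismProperty.Over.mk ⊤ q ((isRegularEpi_iff_surjective q).2 hq),
    MorphismProperty.Over.homMk (GrpCat.ofHom (QuotientGroup.mk' N)) rfl,
    QuotientGroup.mk'_surjective N, QuotientGroup.ker_mk' N⟩

end Over

section BaseChange

variable {E B : GrpCat.{w}} (p : E ⟶ B) {X Y Z : ΓTF.{w}.ext.Over ⊤ B}

/-- The projection to `X` of the pullback of the extension `X` along `p`. -/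
noncomputable def pullbackFst (X : ΓTF.{w}.ext.Over ⊤ B) :
    ((ΓTF.pullbackFunctor p).obj X).left ⟶ X.left :=
  pullback.fst X.hom p

lemma isPullback_pullbackFst (X : ΓTF.{w}.ext.Over ⊤ B) :
    IsPullback (pullbackFst p X) ((ΓTF.pullbackFunctor p).obj X).hom X.hom p :=
  IsPullback.of_hasPullback X.hom p

lemma pullbackFst_map_apply (g : X ⟶ Y) (z : ((ΓTF.pullbackFunctor p).obj X).left) :
    (pullbackFst p Y).hom (((ΓTF.pullbackFunctor p).map g).left.hom z) =
      g.left.hom ((pullbackFst p X).hom z) :=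
  ConcreteCategory.congr_hom (pullback.lift_fst (pullback.fst X.hom p ≫ g.left)
    (pullback.snd X.hom p) (by rw [Category.assoc, MorphismProperty.Over.w, pullback.condition])) z

lemma pullbackFunctor_map_eq_one_iff (g : X ⟶ Y) {z : ((ΓTF.pullbackFunctor p).obj X).left} :
    ((ΓTF.pullbackFunctor p).map g).left.hom z = 1 ↔
      g.left.hom ((pullbackFst p X).hom z) = 1 ∧ ((ΓTF.pullbackFunctor p).obj X).hom.hom z = 1 := by
  rw [← pullbackFst_map_apply, ← over_w_apply ((ΓTF.pullbackFunctor p).map g)]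
  refine ⟨fun h => ?_, fun h => eq_one_of_isPullback (isPullback_pullbackFst p Y) h.1 h.2⟩
  rw [h]
  exact ⟨map_one _, map_one _⟩

lemma pullbackFunctor_map_surjective {g : X ⟶ Y} (hg : Function.Surjective g.left.hom) :
    Function.Surjective ((ΓTF.pullbackFunctor p).map g).left.hom := fun z => by
  obtain ⟨x, hx⟩ := hg ((pullbackFst p Y).hom z)
  have hxz : X.hom.hom x = p.hom (((ΓTF.pullbackFunctor p).obj Y).hom.hom z) := by
    rw [← over_w_apply g, hx]
    exact ConcreteCategory.congr_hom (isPullback_pullbackFst p Y).w z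
  obtain ⟨t, rfl, ht⟩ := exists_of_isPullback (isPullback_pullbackFst p X) hxz
  refine ⟨t, ext_of_isPullback (isPullback_pullbackFst p Y) ?_ ?_⟩
  · rw [pullbackFst_map_apply, hx]
  · rw [over_w_apply, ht]

variable {p} (hp : Function.Surjective p.hom)

include hp

lemma pullbackFst_surjective (X : ΓTF.{w}.ext.Over ⊤ B) :
    Function.Surjective (pullbackFst p X).hom :=
  surjective_fst_of_isPullback (isPullback_pullbackFst p X) hp

lemma bijective_left_of_bijective_pullbackFunctor_map {g : X ⟶ Y}
    (hg : Function.Bijective ((ΓTF.pullbackFunctor p).map g).left.hom) :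
    Function.Bijective g.left.hom := by
  constructor
  · refine (injective_iff_map_eq_one _).2 fun x hx => ?_
    have hx' : X.hom.hom x = p.hom 1 := by rw [← over_w_apply g, hx, map_one, map_one]
    obtain ⟨z, rfl, hz⟩ := exists_of_isPullback (isPullback_pullbackFst p X) hx'
    have hz' : z = 1 := (injective_iff_map_eq_one _).1 hg.1 z
      ((pullbackFunctor_map_eq_one_iff p g).2 ⟨hx, hz⟩)
    rw [hz', map_one]
  · refine fun y => ?_
    obtain ⟨z, rfl⟩ := pullbackFst_surjective hp Y y
    obtain ⟨t, rfl⟩ := hg.2 z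
    exact ⟨_, (pullbackFst_map_apply p g t).symm⟩

lemma pullbackFunctor_reflectsIsomorphisms :
    (ΓTF.{w}.pullbackFunctor p).ReflectsIsomorphisms where
  reflects {X Y} g hg := by
    have hleft : IsIso ((ΓTF.pullbackFunctor p).map g).left :=
      inferInstanceAs (IsIso ((MorphismProperty.Over.forget _ _ _ ⋙ Over.forget E).map
        ((ΓTF.pullbackFunctor p).map g)))
    have hbij := bijective_left_of_bijective_pullbackFunctor_map hp
      (asIso ((ΓTF.pullbackFunctor p).map g).left).groupIsoToMulEquiv.bijective
    have : IsIso g.left := (MulEquiv.ofBijective g.left.hom hbij).toGrpIso.isIso_hom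
    exact (MorphismProperty.Over.isoMk (asIso g.left) (MorphismProperty.Over.w g)).isIso_hom

lemma coequalizerKer_le_map_pullbackFst (r s : X ⟶ Y) :
    coequalizerKer r.left.hom s.left.hom ≤
      (coequalizerKer ((ΓTF.pullbackFunctor p).map r).left.hom
        ((ΓTF.pullbackFunctor p).map s).left.hom ⊓
          ((ΓTF.pullbackFunctor p).obj Y).hom.hom.ker).map (pullbackFst p Y).hom := by
  have := Subgroup.Normal.map (H := coequalizerKer ((ΓTF.pullbackFunctor p).map r).left.hom
    ((ΓTF.pullbackFunctor p).map s).left.hom ⊓ ((ΓTF.pullbackFunctor p).obj Y).hom.hom.ker)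
    inferInstance _ (pullbackFst_surjective hp Y)
  refine coequalizerKer_le_iff.2 fun x => ?_
  obtain ⟨t, rfl⟩ := pullbackFst_surjective hp X x
  refine ⟨_, ⟨coequalizerKer_le_iff.1 le_rfl t, ?_⟩, ?_⟩
  · refine MonoidHom.mem_ker.2 ?_
    rw [map_div, over_w_apply, over_w_apply, div_self']
  · rw [map_div, pullbackFst_map_apply, pullbackFst_map_apply]

lemma IsGroupCoequalizer.pullbackFunctor_map {r s : X ⟶ Y} {π : Y ⟶ Z}
    (h : IsGroupCoequalizer r.left.hom s.left.hom π.left.hom) :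
    IsGroupCoequalizer ((ΓTF.pullbackFunctor p).map r).left.hom
      ((ΓTF.pullbackFunctor p).map s).left.hom ((ΓTF.pullbackFunctor p).map π).left.hom := by
  refine ⟨pullbackFunctor_map_surjective p h.surjective, le_antisymm (fun z hz => ?_) ?_⟩
  · obtain ⟨hz₁, hz₂⟩ := (pullbackFunctor_map_eq_one_iff p π).1 hz
    obtain ⟨m, ⟨hm, hm₂⟩, hm₁⟩ := coequalizerKer_le_map_pullbackFst hp r s (h.ker_eq.le hz₁)
    rwa [← ext_of_isPullback (isPullback_pullbackFst p Y) hm₁ (hm₂.trans hz₂.symm)]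
  · have hw : (ΓTF.pullbackFunctor p).map r ≫ (ΓTF.pullbackFunctor p).map π =
        (ΓTF.pullbackFunctor p).map s ≫ (ΓTF.pullbackFunctor p).map π := by
      rw [← Functor.map_comp, h.w, Functor.map_comp]
    exact coequalizerKer_le_ker_iff.2 (congrArg (fun k => k.left.hom) hw)

lemma isMonadicExtension_of_surjective : ΓTF.{w}.IsMonadicExtension p := by
  have hext : ΓTF.{w}.ext p := (isRegularEpi_iff_surjective p).2 hp
  have := ΓTF.{w}.stable
  have : ΓTF.{w}.ext.IsStableUnderComposition := ⟨fun f g => ΓTF.comp_mem f g⟩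
  have := pullbackFunctor_reflectsIsomorphisms hp
  have : Monad.HasCoequalizerOfIsSplitPair (ΓTF.{w}.pullbackFunctor p) := ⟨fun r s _ => by
    obtain ⟨Z, π, h⟩ := exists_isGroupCoequalizer r s
    obtain ⟨hc⟩ := h.nonempty_isColimit
    exact ⟨⟨⟨_, hc⟩⟩⟩⟩
  have : Monad.PreservesColimitOfIsSplitPair (ΓTF.{w}.pullbackFunctor p) := ⟨fun r s _ => by
    obtain ⟨Z, π, h⟩ := exists_isGroupCoequalizer r s
    obtain ⟨hc⟩ := h.nonempty_isColimit
    obtain ⟨hc'⟩ := (h.pullbackFunctor_map hp).nonempty_isColimit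
    exact preservesColimit_of_preserves_colimit_cocone hc
      ((isColimitMapCoconeCoforkEquiv _ h.w).symm hc')⟩
  exact ⟨hext, ⟨Monad.monadicOfHasPreservesGSplitCoequalizersOfReflectsIsomorphisms
    (MorphismProperty.Over.mapPullbackAdj ΓTF.ext ⊤ p hext trivial)⟩⟩

end BaseChange

section ReflMap

variable {X Y : GrpCat.{w}}

/-- The homomorphism `I(f)`. -/
noncomputable def reflMap (f : X ⟶ Y) : ReflObj X →* ReflObj Y :=
  (ΓTF.I.map f).hom.hom

lemma reflMap_reflUnit (f : X ⟶ Y) (x : X) : reflMap f (reflUnit X x) = reflUnit Y (f.hom x) :=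
  ConcreteCategory.congr_hom (reflAdj.unit.naturality f).symm x

lemma reflUnit_hom_eq_one (f : X ⟶ Y) {x : X} (hx : reflUnit X x = 1) :
    reflUnit Y (f.hom x) = 1 := by
  rw [← reflMap_reflUnit, hx, map_one]

lemma isTrivialExtension_iff_disjoint {s : X ⟶ Y} {δ : Y ⟶ X} (hδ : δ ≫ s = 𝟙 Y) :
    ΓTF.IsTrivialExtension s ↔ Disjoint (reflUnit X).ker s.hom.ker := by
  have hδs (y : Y) : s.hom (δ.hom y) = y := ConcreteCategory.congr_hom hδ y
  rw [Subgroup.disjoint_def]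
  refine ⟨fun h x => eq_one_of_isPullback h.2, fun h => ⟨?_, ?_⟩⟩
  · exact (isRegularEpi_iff_surjective s).2 fun y => ⟨_, hδs y⟩
  refine isPullback_of_exists_of_eq_one (reflAdj.unit.naturality s).symm ?_ fun x => h
  intro x' y hxy
  obtain ⟨x, rfl⟩ := reflUnit_surjective X x'
  have hy : reflUnit Y ((s.hom x)⁻¹ * y) = 1 := by
    rw [map_mul, map_inv, ← reflMap_reflUnit]
    exact inv_mul_eq_one.2 hxy
  refine ⟨x * δ.hom ((s.hom x)⁻¹ * y), ?_, ?_⟩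
  · change reflUnit X _ = _
    rw [map_mul, reflUnit_hom_eq_one δ hy, mul_one]
  · rw [map_mul, hδs, mul_inv_cancel_left]

end ReflMap

section KernelPair

variable {R E B : GrpCat.{w}} {p : E ⟶ B} {π₁ π₂ : R ⟶ E} (h : IsKernelPair p π₁ π₂)

/-- The homomorphism `k ↦ (k, 1)` to the kernel pair. -/
noncomputable def kernelPairInl : p.hom.ker →* R :=
  (h.lift (GrpCat.ofHom p.hom.ker.subtype) (GrpCat.ofHom 1) <| by
    ext k
    exact k.2.trans (map_one p.hom).symm).hom

lemma fst_kernelPairInl (k : p.hom.ker) : π₁.hom (kernelPairInl h k) = k :=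
  ConcreteCategory.congr_hom
    (h.lift_fst (GrpCat.ofHom p.hom.ker.subtype) (GrpCat.ofHom 1) _) k

lemma snd_kernelPairInl (k : p.hom.ker) : π₂.hom (kernelPairInl h k) = 1 :=
  ConcreteCategory.congr_hom
    (h.lift_snd (GrpCat.ofHom p.hom.ker.subtype) (GrpCat.ofHom 1) _) k

include h

lemma commutator_ker_le_map_fst : ⁅p.hom.ker, (⊤ : Subgroup E)⁆ ≤
    (⁅(⊤ : Subgroup R), (⊤ : Subgroup R)⁆ ⊓ π₂.hom.ker).map π₁.hom := by
  refine Subgroup.commutator_le.2 fun k hk e _ => ?_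
  obtain ⟨x, rfl, hx⟩ := exists_of_isPullback h (hk.trans (map_one p.hom).symm)
  obtain ⟨y, rfl, -⟩ := exists_of_isPullback h (rfl : p.hom e = p.hom e)
  refine ⟨⁅x, y⁆, ⟨Subgroup.commutator_mem_commutator trivial trivial, ?_⟩,
    map_commutatorElement _ _ _⟩
  refine MonoidHom.mem_ker.2 ?_
  rw [map_commutatorElement, hx, commutatorElement_one_left]

lemma reflUnit_eq_one_iff_of_snd_eq_one {z : R} (hz : π₂.hom z = 1) :
    reflUnit R z = 1 ↔ π₁.hom z ∈ hopfDen p.hom.ker := by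
  constructor
  · intro hz'
    have hw : p.hom.comp π₁.hom = p.hom.comp π₂.hom := congrArg GrpCat.Hom.hom h.w
    simpa only [hz, div_one] using div_mem_hopfDen hw hz'
  · rintro ⟨-, n, hn, hzn⟩
    obtain ⟨c, ⟨hc, hc₂⟩, hc₁⟩ := commutator_ker_le_map_fst h hzn
    have hcz : z ^ n = c := ext_of_isPullback h (by rw [map_pow, hc₁])
      (by rw [map_pow, hz, one_pow]; exact hc₂.symm)
    exact reflUnit_eq_one_iff.2 ⟨n, hn, hcz ▸ hc⟩

lemma disjoint_ker_reflUnit_iff :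
    Disjoint (reflUnit R).ker π₂.hom.ker ↔ hopfDen p.hom.ker = ⊥ := by
  rw [Subgroup.disjoint_def, Subgroup.eq_bot_iff_forall]
  constructor
  · intro hdisj k hk
    have hinl : kernelPairInl h ⟨k, hk.1⟩ = 1 := by
      refine hdisj ?_ (snd_kernelPairInl h _)
      exact (reflUnit_eq_one_iff_of_snd_eq_one h (snd_kernelPairInl h _)).2
        (by rwa [fst_kernelPairInl])
    exact (fst_kernelPairInl h ⟨k, hk.1⟩).symm.trans (by rw [hinl, map_one])
  · intro hbot z hz₁ hz₂
    exact eq_one_of_isPullback h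
      (hbot _ ((reflUnit_eq_one_iff_of_snd_eq_one h hz₂).1 hz₁)) hz₂

end KernelPair

lemma isNormalExtension_iff {E B : GrpCat.{w}} {p : E ⟶ B} :
    ΓTF.IsNormalExtension p ↔ Function.Surjective p.hom ∧ hopfDen p.hom.ker = ⊥ := by
  refine and_congr ⟨fun h => (isRegularEpi_iff_surjective p).1 h.1,
    isMonadicExtension_of_surjective⟩ ?_
  exact (isTrivialExtension_iff_disjoint (pullback.diagonal_snd p)).trans
    (disjoint_ker_reflUnit_iff (IsPullback.of_hasPullback p p))

section KernelPairReflection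

variable {R E B : GrpCat.{w}} {p : E ⟶ B} {π₁ π₂ : R ⟶ E} (h : IsKernelPair p π₁ π₂)

/-- The homomorphism `k ↦ [(k, 1)]` to the reflection of the kernel pair. -/
noncomputable def hopfNumToRefl : hopfNum p.hom.ker →* ReflObj R :=
  (reflUnit R).comp ((kernelPairInl h).comp (Subgroup.inclusion fun _ hx => hx.1))

lemma ker_hopfNumToRefl :
    (hopfNumToRefl h).ker = (hopfDen p.hom.ker).subgroupOf (hopfNum p.hom.ker) := by
  ext k
  refine (reflUnit_eq_one_iff_of_snd_eq_one h (snd_kernelPairInl h _)).trans ?_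
  rw [fst_kernelPairInl]
  rfl

lemma range_hopfNumToRefl :
    (hopfNumToRefl h).range = (reflMap π₁).ker ⊓ (reflMap π₂).ker := by
  apply le_antisymm
  · rintro _ ⟨k, rfl⟩
    refine ⟨(reflMap_reflUnit _ _).trans ?_, (reflMap_reflUnit _ _).trans ?_⟩
    · exact (congrArg _ (fst_kernelPairInl h _)).trans (mem_hopfNum_iff.1 k.2).2
    · exact (congrArg _ (snd_kernelPairInl h _)).trans (map_one _)
  · rintro y ⟨hy₁, hy₂⟩
    obtain ⟨r, rfl⟩ := reflUnit_surjective R y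
    replace hy₁ : reflUnit E (π₁.hom r) = 1 := (reflMap_reflUnit _ _).symm.trans hy₁
    replace hy₂ : reflUnit E (π₂.hom r) = 1 := (reflMap_reflUnit _ _).symm.trans hy₂
    obtain ⟨δ, hδ₁, hδ₂⟩ := h.lift' (𝟙 E) (𝟙 E) rfl
    let k : hopfNum p.hom.ker := ⟨π₁.hom r / π₂.hom r, mem_hopfNum_iff.2
      ⟨div_mem_ker (congrArg GrpCat.Hom.hom h.w) r, by rw [map_div, hy₁, hy₂, div_one]⟩⟩
    have hr : kernelPairInl h ⟨k, k.2.1⟩ * δ.hom (π₂.hom r) = r := by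
      refine ext_of_isPullback h ?_ ?_
      · rw [map_mul, fst_kernelPairInl]
        exact (congrArg _ (ConcreteCategory.congr_hom hδ₁ _)).trans (div_mul_cancel _ _)
      · rw [map_mul, snd_kernelPairInl, one_mul]
        exact ConcreteCategory.congr_hom hδ₂ _
    refine ⟨k, ?_⟩
    calc hopfNumToRefl h k
        = reflUnit R (kernelPairInl h ⟨k, k.2.1⟩) * reflUnit R (δ.hom (π₂.hom r)) := by
          rw [reflUnit_hom_eq_one δ hy₂, mul_one]; rfl
      _ = reflUnit R r := by rw [← map_mul, hr]

/-- The Hopf quotient of `ker p` as the intersection of the kernels of `I(π₁)` and `I(π₂)`, for a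
kernel pair `(π₁, π₂)` of `p`. -/
noncomputable def hopfQuotientEquivKer :
    HopfQuotient p.hom.ker ≃* ((reflMap π₁).ker ⊓ (reflMap π₂).ker : Subgroup (ReflObj R)) :=
  (QuotientGroup.quotientMulEquivOfEq (ker_hopfNumToRefl h).symm).trans <|
    (QuotientGroup.quotientKerEquivRange (hopfNumToRefl h)).trans <|
      MulEquiv.subgroupCongr (range_hopfNumToRefl h)

end KernelPairReflection

section GaloisGroup

open scoped ZeroObject

section Kernel

variable {W X Y S : GrpCat.{w}} {fst : W ⟶ X} {snd : W ⟶ Y} {f : X ⟶ S} {g : Y ⟶ S}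
  [Subsingleton Y]

lemma injective_fst_of_isPullback (h : IsPullback fst snd f g) : Function.Injective fst.hom :=
  (injective_iff_map_eq_one _).2 fun _ hz => eq_one_of_isPullback h hz (Subsingleton.elim _ _)

lemma range_fst_of_isPullback (h : IsPullback fst snd f g) : fst.hom.range = f.hom.ker := by
  ext x
  constructor
  · rintro ⟨z, rfl⟩
    refine (ConcreteCategory.congr_hom h.w z).trans ?_
    exact (congrArg g.hom (Subsingleton.elim (snd.hom z) 1)).trans (map_one _)
  · intro hx
    obtain ⟨z, hz, -⟩ := exists_of_isPullback h (hx.trans (map_one g.hom).symm)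
    exact ⟨z, hz⟩

/-- The pullback of `f` along a homomorphism from a trivial group, as the kernel of `f`. -/
noncomputable def equivKerOfIsPullback (h : IsPullback fst snd f g) : W ≃* f.hom.ker :=
  (MonoidHom.ofInjective (injective_fst_of_isPullback h)).trans
    (MulEquiv.subgroupCongr (range_fst_of_isPullback h))

end Kernel

variable {X Y Z : ΓTF.{w}.Sub}

lemma isAbTF_subgroup (N : Subgroup X.obj) : isAbTF (GrpCat.of N) := by
  obtain ⟨hcomm, htf⟩ := X.property
  exact ⟨inferInstance, inferInstance⟩

lemma ker_prodLift (a : X ⟶ Y) (b : X ⟶ Z) :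
    (prod.lift a b).hom.hom.ker = a.hom.hom.ker ⊓ b.hom.hom.ker := by
  apply le_antisymm
  · refine le_inf (fun x hx => ?_) fun x hx => ?_
    · refine (ConcreteCategory.congr_hom (prod.lift_fst a b) x).symm.trans ?_
      exact (congrArg (prod.fst : Y ⨯ Z ⟶ Y).hom.hom hx).trans (map_one _)
    · refine (ConcreteCategory.congr_hom (prod.lift_snd a b) x).symm.trans ?_
      exact (congrArg (prod.snd : Y ⨯ Z ⟶ Z).hom.hom hx).trans (map_one _)
  · intro x hx
    let N : Subgroup X.obj := a.hom.hom.ker ⊓ b.hom.hom.ker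
    let T : ΓTF.{w}.Sub := ⟨GrpCat.of N, isAbTF_subgroup N⟩
    let i : T ⟶ X := ObjectProperty.homMk (GrpCat.ofHom N.subtype)
    let e : T ⟶ Y ⨯ Z := ObjectProperty.homMk (GrpCat.ofHom 1)
    have hi : i ≫ prod.lift a b = e := by
      apply Limits.prod.hom_ext
      · rw [Category.assoc, prod.lift_fst]
        ext n
        exact n.2.1.trans (map_one (prod.fst : Y ⨯ Z ⟶ Y).hom.hom).symm
      · rw [Category.assoc, prod.lift_snd]
        ext n
        exact n.2.2.trans (map_one (prod.snd : Y ⨯ Z ⟶ Z).hom.hom).symm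
    exact ConcreteCategory.congr_hom hi (⟨x, hx⟩ : N)

lemma subsingleton_of_isZero (hX : IsZero X) : Subsingleton X.obj := by
  have h : 𝟙 X = ObjectProperty.homMk (GrpCat.ofHom 1) := hX.eq_of_src _ _
  exact subsingleton_of_forall_eq 1 fun x => congrArg (fun k => k.hom.hom x) h

/-- The pullback of a morphism along the zero morphism is its kernel. -/
noncomputable def pullbackZeroEquiv (g : X ⟶ Y) :
    (pullback g ((isZero_zero ΓTF.{w}.Sub).to_ Y)).obj ≃* g.hom.hom.ker :=
  have := ΓTF.{w}.adj.rightAdjoint_preservesLimits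
  have : Subsingleton (ΓTF.{w}.sub.ι.obj 0) := subsingleton_of_isZero (isZero_zero ΓTF.{w}.Sub)
  equivKerOfIsPullback ((IsPullback.of_hasPullback g _).map ΓTF.{w}.sub.ι)

/-- The Galois group of an arbitrary homomorphism, as a Hopf quotient. -/
noncomputable def galoisGroupEquiv {E B : GrpCat.{w}} (p : E ⟶ B) :
    (ΓTF.galoisGroup p).obj ≃* HopfQuotient p.hom.ker :=
  (pullbackZeroEquiv _).trans <| (MulEquiv.subgroupCongr (ker_prodLift _ _)).trans
    (hopfQuotientEquivKer (IsPullback.of_hasPullback p p)).symm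

end GaloisGroup

section WeaklyUniversal

variable {B P : Type w} [Group B] [Group P] {f : P →* B}

lemma isWeaklyUniversal_centralReflection (hf : Function.Surjective f)
    (hlift : ∀ (E : GrpCat.{w}) (p : E ⟶ GrpCat.of B), ΓTF.IsNormalExtension p →
      ∃ φ : P →* E, p.hom.comp φ = f) :
    ΓTF.IsWeaklyUniversal (GrpCat.ofHom (centralReflection f)) := by
  refine ⟨isNormalExtension_iff.2 ⟨centralReflection_surjective hf,
    hopfDen_ker_centralReflection⟩, fun E p hp => ?_⟩
  obtain ⟨φ, hφ⟩ := hlift E p hp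
  obtain ⟨u, hu⟩ := exists_comp_eq_centralReflection (isNormalExtension_iff.1 hp).2 hφ
  exact ⟨GrpCat.ofHom u, GrpCat.hom_ext hu⟩

end WeaklyUniversal

end GaloisPiOne

theorem mainTheorem7_general (B P : Type w) [Group B] [Group P] (f : P →* B)
    (hf : Function.Surjective f)
    (hlift : ∀ (E : GrpCat.{w}) (p : E ⟶ GrpCat.of B), GaloisPiOne.ΓTF.IsNormalExtension p →
      ∃ φ : P →* E, p.hom.comp φ = f) :
    (∃ (E : GrpCat.{w}) (p : E ⟶ GrpCat.of B), GaloisPiOne.ΓTF.IsWeaklyUniversal p) ∧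
    ∀ (E : GrpCat.{w}) (p : E ⟶ GrpCat.of B), GaloisPiOne.ΓTF.IsWeaklyUniversal p →
      Nonempty ((GaloisPiOne.ΓTF.galoisGroup p).obj ≃* GaloisPiOne.HopfQuotient f.ker) := by
  have huniv := GaloisPiOne.isWeaklyUniversal_centralReflection hf hlift
  refine ⟨⟨_, _, huniv⟩, fun E p hp => ?_⟩
  obtain ⟨u, hu⟩ := hp.2 _ _ huniv.1
  obtain ⟨v, hv⟩ := huniv.2 _ _ hp.1
  have e : GaloisPiOne.HopfQuotient p.hom.ker ≃*
      GaloisPiOne.HopfQuotient (GaloisPiOne.centralReflection f).ker :=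
    GaloisPiOne.hopfEquiv u.hom (congrArg GrpCat.Hom.hom hu) v.hom (congrArg GrpCat.Hom.hom hv)
  exact ⟨((GaloisPiOne.galoisGroupEquiv p).trans e).trans
    (GaloisPiOne.centralReflectionEquiv f).symm⟩

theorem mainTheorem7 (B P : Type w) [Group B] [Group P] [IsFreeGroup P] (f : P →* B)
    (hf : Function.Surjective f) :
    (∃ (E : GrpCat.{w}) (p : E ⟶ GrpCat.of B), GaloisPiOne.ΓTF.IsWeaklyUniversal p) ∧
    ∀ (E : GrpCat.{w}) (p : E ⟶ GrpCat.of B), GaloisPiOne.ΓTF.IsWeaklyUniversal p →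
      Nonempty ((GaloisPiOne.ΓTF.galoisGroup p).obj ≃* GaloisPiOne.HopfQuotient f.ker) :=
  mainTheorem7_general B P f hf fun _ _ hp =>
    GaloisPiOne.exists_comp_eq_of_isFreeGroup (GaloisPiOne.isNormalExtension_iff.1 hp).1 f
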